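/- Consider the first-order system in $\mathbf{R}^4$ $$\Phi' = \bigl(\Phi_2,\ \Phi_3,\ \Phi_4,\ F_1(\Phi_1,\Phi_3)+\Phi_2^2F_2(\Phi_1,\Phi_3)\bigr),$$ $$F_1(\Phi_1,\Phi_3) = -\tfrac92\sin(2\Phi_1)+(7+3\cos(2\Phi_1))\Phi_3,\qquad F_2(\Phi_1,\Phi_3)=3(2\Phi_3-\sin(2\Phi_1)).$$ Let $W^u(0)$ be the unstable manifold of the origin, i.e. the set of all points $p\in\mathbf{R}^4$ for which there is a solution $\Psi:(-\infty,0]\to\mathbf{R}^4$ with $\Psi(0)=p$ and $\Psi(s)\to 0$ as $s\to-\infty$. Let $y(s)=2\arctan(e^s)$ and $Y=(y,y',y'',y''')$. Suppose that $\Phi:(-\infty,s_{\max})\to\mathbf{R}^4$, $s_{\max}\in(-\infty,\infty]$, is a solution that cannot be continued as a solution beyond $s_{\max}$, that takes values in $W^u(0)$ and that is not identically zero. Then exactly one of the following holds: 1. $s_{\max}=\infty$, and there is a $\tau\in\mathbf{R}$ such that either $\Phi(s)=Y(s+\tau)$ for all $s\in\mathbf{R}$, or $\Phi(s)=-Y(s+\tau)$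 for all $s\in\mathbf{R}$; 2. $\Phi$ blows up in finite time, that is, $s_{\max}<\infty$ and $\lim_{s\nearrow s_{\max}}|\Phi(s)|=\infty$. -/

import Mathlib

open Filter Topology

namespace EquivariantBiharmonic

/-- The phase space `ℝ⁴` with its Euclidean norm; the coordinates `Φ₁, Φ₂, Φ₃, Φ₄` are
`Φ 0, Φ 1, Φ 2, Φ 3`. -/
abbrev Phase : Type := EuclideanSpace ℝ (Fin 4)

/-- `F₁(Φ₁, Φ₃)`. -/
noncomputable def F₁ (x z : ℝ) : ℝ :=
  -(9 / 2) * Real.sin (2 * x) + (7 + 3 * Real.cos (2 * x)) * z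

/-- `F₂(Φ₁, Φ₃)`. -/
noncomputable def F₂ (x z : ℝ) : ℝ :=
  3 * (2 * z - Real.sin (2 * x))

/-- The right-hand side `(Φ₂, Φ₃, Φ₄, F₁(Φ₁, Φ₃) + Φ₂² F₂(Φ₁, Φ₃))` of the first-order system. -/
noncomputable def field (p : Phase) : Phase :=
  !₂[p 1, p 2, p 3, F₁ (p 0) (p 2) + p 1 ^ 2 * F₂ (p 0) (p 2)]

/-- The curve `Φ` solves the autonomous first-order system on the set `I` of times. -/
def SolvesOn (Φ : ℝ → Phase) (I : Set ℝ) : Prop :=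
  IsIntegralCurveOn Φ (fun _ => field) I

/-- The interval `(-∞, b)` of real numbers, where `b` may be `∞`. -/
def before (b : EReal) : Set ℝ := {s | (s : EReal) < b}

/-- `Φ : (-∞, smax) → ℝ⁴` is a solution that cannot be continued to the right as a solution.
The values of `Φ` outside `(-∞, smax)` play no role. -/
def IsMaximalSolution (Φ : ℝ → Phase) (smax : EReal) : Prop :=
  SolvesOn Φ (before smax) ∧
    ∀ b : EReal, smax < b →
      ¬ ∃ Ψ : ℝ → Phase, SolvesOn Ψ (before b) ∧ Set.EqOn Ψ Φ (before smax)

/-- The (global) unstable manifold `W^u(0)` of the origin: the points whose backward solution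
exists for all negative times and converges to the origin. -/
def unstableManifold : Set Phase :=
  {p | ∃ Ψ : ℝ → Phase, SolvesOn Ψ (Set.Iic 0) ∧ Ψ 0 = p ∧ Tendsto Ψ atBot (𝓝 0)}

/-- `y(s) = 2 arctan(eˢ)`. -/
noncomputable def y (s : ℝ) : ℝ := 2 * Real.arctan (Real.exp s)

/-- `Y = (y, y', y'', y''')`. -/
noncomputable def Y (s : ℝ) : Phase :=
  WithLp.toLp 2 fun i : Fin 4 => iteratedDeriv (i : ℕ) y s

end EquivariantBiharmonic

namespace EquivariantBiharmonic

/-! A finite end time forces blow-up: solutions starting in a fixed ball live for a uniform time, so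
returning to that ball arbitrarily close to the end would allow continuation.

For a global solution `(a, b, c, d)` the conserved energy is zero, its value at the origin. With
tension `u = c - sin a cos a` and excess `e = b² - sin² a` this reads `b u' = u²/2 + u sin a cos a +
e (4 + 2 sin² a + 3e/2)`, while `e' = 2 b u`. In the region `b, u > 0`, `e ≥ 0` everything grows
until `b` obeys a Riccati inequality, which contradicts globality (`false_of_pos_tension`).
Reflection and time reversal then give `u = e = 0` wherever `e ≥ 0` and `b ≠ 0`. There the data are
those of a solution of `a' = ± sin a`, so by uniqueness the solution is an explicit translate of
`y`, and its limit at `-∞` leaves only `±Y`.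

It remains to find a time with `e ≥ 0` (`exists_excess_nonneg`). If `e < 0` throughout, `sin a`
never vanishes, so up to sign `a` stays in `(0, π)`. It has no critical point there (`b_ne_zero`),
so it increases; but then `a` would have to leave the strip (`excess_nonneg_of_pos`). -/

/-! ### Uniqueness, continuation and blow-up -/

theorem contDiff_field : ContDiff ℝ 1 field := by
  rw [contDiff_piLp]
  intro i
  fin_cases i <;> simp [field, F₁, F₂] <;> fun_prop

/-- The vector field is Lipschitz on every compact set. -/
theorem exists_lipschitzOnWith_field {K : Set Phase} (hK : IsCompact K) :
    ∃ C, LipschitzOnWith C field K :=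
  (contDiff_field.locallyLipschitz.locallyLipschitzOn).exists_lipschitzOnWith_of_compact hK

theorem SolvesOn.mono {Φ : ℝ → Phase} {I J : Set ℝ} (h : SolvesOn Φ I) (hJ : J ⊆ I) :
    SolvesOn Φ J :=
  IsIntegralCurveOn.mono h hJ

theorem SolvesOn.eqOn_Icc_of_eq_left {Φ Ψ : ℝ → Phase} {a b : ℝ}
    (hΦ : SolvesOn Φ (Set.Icc a b)) (hΨ : SolvesOn Ψ (Set.Icc a b)) (h : Φ a = Ψ a) :
    Set.EqOn Φ Ψ (Set.Icc a b) := by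
  have cΦ := IsIntegralCurveOn.continuousOn hΦ
  have cΨ := IsIntegralCurveOn.continuousOn hΨ
  -- The field is not globally Lipschitz; the union of the two compact images serves as the domain.
  obtain ⟨C, hC⟩ := exists_lipschitzOnWith_field
    ((isCompact_Icc.image_of_continuousOn cΦ).union (isCompact_Icc.image_of_continuousOn cΨ))
  have nhd : ∀ t ∈ Set.Ico a b, Set.Icc a b ∈ 𝓝[≥] t := fun t ht =>
    mem_of_superset (Icc_mem_nhdsGE ht.2) (Set.Icc_subset_Icc_left ht.1)
  refine ODE_solution_unique_of_mem_Icc_right (v := fun _ => field) (fun _ _ => hC) cΦ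
    (fun t ht => ?_) (fun t ht => Or.inl ⟨t, Set.Ico_subset_Icc_self ht, rfl⟩) cΨ
    (fun t ht => ?_) (fun t ht => Or.inr ⟨t, Set.Ico_subset_Icc_self ht, rfl⟩) h
  · exact (hΦ t (Set.Ico_subset_Icc_self ht)).mono_of_mem_nhdsWithin (nhd t ht)
  · exact (hΨ t (Set.Ico_subset_Icc_self ht)).mono_of_mem_nhdsWithin (nhd t ht)

theorem SolvesOn.eqOn_Icc_of_eq_right {Φ Ψ : ℝ → Phase} {a b : ℝ}
    (hΦ : SolvesOn Φ (Set.Icc a b)) (hΨ : SolvesOn Ψ (Set.Icc a b)) (h : Φ b = Ψ b) :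
    Set.EqOn Φ Ψ (Set.Icc a b) := by
  have cΦ := IsIntegralCurveOn.continuousOn hΦ
  have cΨ := IsIntegralCurveOn.continuousOn hΨ
  obtain ⟨C, hC⟩ := exists_lipschitzOnWith_field
    ((isCompact_Icc.image_of_continuousOn cΦ).union (isCompact_Icc.image_of_continuousOn cΨ))
  have nhd : ∀ t ∈ Set.Ioc a b, Set.Icc a b ∈ 𝓝[≤] t := fun t ht =>
    mem_of_superset (Icc_mem_nhdsLE ht.1) (Set.Icc_subset_Icc_right ht.2)
  refine ODE_solution_unique_of_mem_Icc_left (v := fun _ => field) (fun _ _ => hC) cΦ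
    (fun t ht => ?_) (fun t ht => Or.inl ⟨t, Set.Ioc_subset_Icc_self ht, rfl⟩) cΨ
    (fun t ht => ?_) (fun t ht => Or.inr ⟨t, Set.Ioc_subset_Icc_self ht, rfl⟩) h
  · exact (hΦ t (Set.Ioc_subset_Icc_self ht)).mono_of_mem_nhdsWithin (nhd t ht)
  · exact (hΨ t (Set.Ioc_subset_Icc_self ht)).mono_of_mem_nhdsWithin (nhd t ht)

/-- Two solutions on an interval that agree at one time agree on the interval. -/
theorem SolvesOn.eqOn {Φ Ψ : ℝ → Phase} {I : Set ℝ} [hI : I.OrdConnected] {t : ℝ}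
    (hΦ : SolvesOn Φ I) (hΨ : SolvesOn Ψ I) (ht : t ∈ I) (h : Φ t = Ψ t) :
    Set.EqOn Φ Ψ I := by
  intro s hs
  rcases le_total s t with hst | hst
  · exact (hΦ.mono (hI.out hs ht)).eqOn_Icc_of_eq_right (hΨ.mono (hI.out hs ht)) h
      (Set.left_mem_Icc.2 hst)
  · exact (hΦ.mono (hI.out ht hs)).eqOn_Icc_of_eq_left (hΨ.mono (hI.out ht hs)) h
      (Set.right_mem_Icc.2 hst)

/-- On a bounded set of initial values, solutions exist for a uniform time. -/
theorem exists_uniform_existence_time (R : ℝ) :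
    ∃ ε > 0, ∀ x : Phase, ‖x‖ ≤ R → ∀ t : ℝ, ∃ α : ℝ → Phase,
      α t = x ∧ SolvesOn α (Set.Ioo (t - ε) (t + ε)) := by
  have key : ∃ ε > 0, ∀ x ∈ Metric.closedBall (0 : Phase) R, ∃ α : ℝ → Phase,
      α 0 = x ∧ SolvesOn α (Set.Ioo (0 - ε) (0 + ε)) := by
    refine (isCompact_closedBall (0 : Phase) R).induction_on
      (p := fun K => ∃ ε > 0, ∀ x ∈ K, ∃ α : ℝ → Phase,
        α 0 = x ∧ SolvesOn α (Set.Ioo (0 - ε) (0 + ε))) ⟨1, one_pos, by simp⟩ ?_ ?_ ?_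
    · rintro K L hKL ⟨ε, hε, h⟩
      exact ⟨ε, hε, fun x hx => h x (hKL hx)⟩
    · rintro K L ⟨ε, hε, h⟩ ⟨δ, hδ, h'⟩
      refine ⟨min ε δ, lt_min hε hδ, ?_⟩
      rintro x (hx | hx)
      · obtain ⟨α, h0, hα⟩ := h x hx
        exact ⟨α, h0, hα.mono (Set.Ioo_subset_Ioo (by gcongr; exact min_le_left _ _)
          (by gcongr; exact min_le_left _ _))⟩
      · obtain ⟨α, h0, hα⟩ := h' x hx
        exact ⟨α, h0, hα.mono (Set.Ioo_subset_Ioo (by gcongr; exact min_le_right _ _)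
          (by gcongr; exact min_le_right _ _))⟩
    · intro x _
      obtain ⟨r, hr, ε, hε, h⟩ :=
        contDiff_field.contDiffAt.exists_forall_mem_closedBall_exists_eq_forall_mem_Ioo_hasDerivAt
          (x₀ := x) 0
      refine ⟨_, mem_nhdsWithin_of_mem_nhds (Metric.closedBall_mem_nhds x hr), ε, hε,
        fun z hz => ?_⟩
      obtain ⟨α, h0, hα⟩ := h z hz
      exact ⟨α, h0, fun t ht => (hα t ht).hasDerivWithinAt⟩
  obtain ⟨ε, hε, h⟩ := key
  refine ⟨ε, hε, fun x hx t => ?_⟩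
  obtain ⟨α, h0, hα⟩ := h x (by simpa using hx)
  refine ⟨fun s => α (s - t), by simpa using h0, fun s hs => ?_⟩
  have hs' : s - t ∈ Set.Ioo (0 - ε) (0 + ε) := ⟨by linarith [hs.1], by linarith [hs.2]⟩
  exact (((hα _ hs').hasDerivAt (Ioo_mem_nhds hs'.1 hs'.2)).comp_sub_const s t).hasDerivWithinAt

theorem before_coe (T : ℝ) : before (T : EReal) = Set.Iio T := by
  ext s; simp [before]

/-- A maximal solution whose life ends at a finite time blows up there. -/
theorem IsMaximalSolution.tendsto_norm_atTop {Φ : ℝ → Phase} {T : ℝ}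
    (h : IsMaximalSolution Φ T) : Tendsto (fun s => ‖Φ s‖) (𝓝[<] T) atTop := by
  obtain ⟨hΦ, hmax⟩ := h
  rw [before_coe] at hΦ hmax
  by_contra hlim
  rw [tendsto_atTop] at hlim
  push Not at hlim
  obtain ⟨R, hR⟩ := hlim
  obtain ⟨ε, hε, hex⟩ := exists_uniform_existence_time R
  -- A restart at a time `t > T - ε` with `‖Φ t‖ < R` survives past `T`; gluing it to `Φ`
  -- contradicts maximality.
  obtain ⟨t, htR, htε⟩ := (hR.and_eventually (Ioo_mem_nhdsLT (sub_lt_self T hε))).exists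
  obtain ⟨α, hαt, hα⟩ := hex (Φ t) htR.le t
  have heq : Set.EqOn Φ α (Set.Ioo (t - ε) T) :=
    (hΦ.mono fun s hs => hs.2).eqOn (t := t)
      (hα.mono (Set.Ioo_subset_Ioo_right (by linarith [htε.1])))
      ⟨by linarith, htε.2⟩ hαt.symm
  have hlt : T < t + ε := by linarith [htε.1]
  refine hmax ((t + ε : ℝ) : EReal) (by exact_mod_cast hlt)
    ⟨fun s => if s < T then Φ s else α s, ?_, fun s hs => if_pos hs⟩
  rw [before_coe]
  intro s hs
  refine HasDerivAt.hasDerivWithinAt ?_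
  rcases lt_or_ge s T with hsT | hsT
  · have : (fun s => if s < T then Φ s else α s) =ᶠ[𝓝 s] Φ := by
      filter_upwards [Iio_mem_nhds hsT] with r hr using if_pos hr
    simp only [if_pos hsT]
    exact ((hΦ s hsT).hasDerivAt (Iio_mem_nhds hsT)).congr_of_eventuallyEq this
  · have hmem : s ∈ Set.Ioo (t - ε) (t + ε) := ⟨by linarith [htε.2], hs⟩
    have : (fun s => if s < T then Φ s else α s) =ᶠ[𝓝 s] α := by
      filter_upwards [Ioo_mem_nhds hmem.1 hmem.2] with r hr
      split_ifs with hrT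
      · exact heq ⟨hr.1, hrT⟩
      · rfl
    simp only [if_neg hsT.not_gt]
    exact ((hα s hmem).hasDerivAt (Ioo_mem_nhds hmem.1 hmem.2)).congr_of_eventuallyEq this


/-! ### Barrier and comparison arguments on the line -/

section RealFunctions

theorem hasDerivAt_comp_neg {f : ℝ → ℝ} {f' s : ℝ} (h : HasDerivAt f f' (-s)) :
    HasDerivAt (fun s => f (-s)) (-f') s := by
  simpa [Function.comp_def] using h.scomp s (hasDerivAt_neg s)

theorem eventually_lt_nhdsGT_of_deriv_pos {f : ℝ → ℝ} {f' t : ℝ} (hf : HasDerivAt f f' t)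
    (h : 0 < f') : ∀ᶠ s in 𝓝[>] t, f t < f s := by
  have := (hasDerivAt_iff_tendsto_slope.1 hf).mono_left (nhdsGT_le_nhdsNE t)
  filter_upwards [this.eventually_const_lt h, self_mem_nhdsWithin] with s hs hts
  rw [slope_def_field] at hs
  have := (div_pos_iff_of_pos_right (sub_pos.2 hts)).1 hs
  linarith

theorem eventually_lt_nhdsLT_of_deriv_pos {f : ℝ → ℝ} {f' t : ℝ} (hf : HasDerivAt f f' t)
    (h : 0 < f') : ∀ᶠ s in 𝓝[<] t, f s < f t := by
  have := (hasDerivAt_iff_tendsto_slope.1 hf).mono_left (nhdsLT_le_nhdsNE t)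
  filter_upwards [this.eventually_const_lt h, self_mem_nhdsWithin] with s hs hts
  rw [slope_def_field] at hs
  have hts : s - t < 0 := sub_neg.2 hts
  by_contra! hle
  exact absurd hs (not_lt.2 (div_nonpos_of_nonneg_of_nonpos (sub_nonneg.2 hle) hts.le))

/-- A function whose derivative is positive just after `t` increases just after `t`. -/
theorem eventually_lt_nhdsGT_of_deriv_eventually_pos {f f' : ℝ → ℝ} {t : ℝ}
    (hf : ∀ s, HasDerivAt f (f' s) s) (h : ∀ᶠ s in 𝓝[>] t, 0 < f' s) :
    ∀ᶠ s in 𝓝[>] t, f t < f s := by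
  obtain ⟨r, hr, hpos⟩ := mem_nhdsGT_iff_exists_Ioo_subset.1 h
  filter_upwards [Ioo_mem_nhdsGT hr] with s hs
  have hmono : StrictMonoOn f (Set.Icc t s) := by
    refine strictMonoOn_of_deriv_pos (convex_Icc t s)
      (fun x _ => (hf x).continuousAt.continuousWithinAt) fun x hx => ?_
    rw [interior_Icc] at hx
    rw [(hf x).deriv]
    exact hpos ⟨hx.1, hx.2.trans hs.2⟩
  exact hmono (Set.left_mem_Icc.2 hs.1.le) (Set.right_mem_Icc.2 hs.1.le) hs.1

/-- A function that is positive at `t₀` and has a positive derivative wherever it would vanish for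
the first time stays positive. -/
theorem pos_of_deriv_pos_at_first_zero {f f' : ℝ → ℝ} {t₀ : ℝ}
    (hf : ∀ s, HasDerivAt f (f' s) s) (h₀ : 0 < f t₀)
    (h : ∀ t > t₀, (∀ s ∈ Set.Ico t₀ t, 0 < f s) → f t = 0 → 0 < f' t) {s : ℝ} (hs : t₀ ≤ s) :
    0 < f s := by
  by_contra! hneg
  have hcont : Continuous f := continuous_iff_continuousAt.2 fun x => (hf x).continuousAt
  set Z : Set ℝ := {x | t₀ ≤ x ∧ f x ≤ 0}
  have hZ : IsClosed Z := isClosed_Ici.inter (isClosed_le hcont continuous_const)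
  have hbdd : BddBelow Z := ⟨t₀, fun x hx => hx.1⟩
  have hmem : sInf Z ∈ Z := hZ.csInf_mem ⟨s, hs, hneg⟩ hbdd
  set t := sInf Z
  have hlt : t₀ < t := lt_of_le_of_ne hmem.1 fun heq => by
    have := hmem.2
    rw [← heq] at this
    linarith
  have hpos : ∀ x ∈ Set.Ico t₀ t, 0 < f x := fun x hx => by
    by_contra! hx0
    exact absurd (csInf_le hbdd (show x ∈ Z from ⟨hx.1, hx0⟩)) (not_le.2 hx.2)
  have hge : 0 ≤ f t := by
    refine ge_of_tendsto ((hcont.tendsto t).mono_left (nhdsWithin_le_nhds (s := Set.Iio t))) ?_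
    filter_upwards [Ioo_mem_nhdsLT hlt] with x hx using (hpos x ⟨hx.1.le, hx.2⟩).le
  have h0 : f t = 0 := le_antisymm hmem.2 hge
  obtain ⟨x, hx, hx'⟩ := ((eventually_lt_nhdsLT_of_deriv_pos (hf t) (h t hlt hpos h0)).and
    (Ioo_mem_nhdsLT hlt)).exists
  exact absurd (hpos x ⟨hx'.1.le, hx'.2⟩) (by linarith)

/-- Linear lower bound from a lower bound on the derivative. -/
theorem add_mul_sub_le_of_le_deriv {f f' : ℝ → ℝ} {t₀ m : ℝ} (hf : ∀ s, HasDerivAt f (f' s) s)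
    (h : ∀ s ≥ t₀, m ≤ f' s) {s : ℝ} (hs : t₀ ≤ s) : f t₀ + m * (s - t₀) ≤ f s := by
  have := (convex_Ici t₀).mul_sub_le_image_sub_of_le_deriv (f := f) (C := m)
    (fun x _ => (hf x).continuousAt.continuousWithinAt)
    (fun x _ => (hf x).differentiableAt.differentiableWithinAt)
    (fun x hx => by
      rw [interior_Ici] at hx
      rw [(hf x).deriv]; exact h x (le_of_lt hx)) t₀ Set.self_mem_Ici s hs hs
  linarith

theorem exists_le_of_le_deriv {f f' : ℝ → ℝ} {t₀ m : ℝ} (hf : ∀ s, HasDerivAt f (f' s) s)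
    (hm : 0 < m) (h : ∀ s ≥ t₀, m ≤ f' s) (M : ℝ) : ∃ t₁ ≥ t₀, ∀ s ≥ t₁, M ≤ f s := by
  refine ⟨max t₀ (t₀ + (M - f t₀) / m), le_max_left _ _, fun s hs => ?_⟩
  have h1 := add_mul_sub_le_of_le_deriv hf h ((le_max_left _ _).trans hs)
  have h2 : (M - f t₀) / m ≤ s - t₀ := by linarith [(le_max_right _ _).trans hs]
  rw [div_le_iff₀ hm] at h2
  linarith

theorem le_of_deriv_nonneg {f f' : ℝ → ℝ} {t₀ : ℝ} (hf : ∀ s, HasDerivAt f (f' s) s)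
    (h : ∀ s ≥ t₀, 0 ≤ f' s) {s : ℝ} (hs : t₀ ≤ s) : f t₀ ≤ f s := by
  simpa using add_mul_sub_le_of_le_deriv hf h hs

/-- A differentiable function on a half-line cannot satisfy `f' ≥ f² / 2 - 1` and be large. -/
theorem false_of_riccati {f f' : ℝ → ℝ} {t₀ : ℝ} (hf : ∀ s, HasDerivAt f (f' s) s)
    (h2 : ∀ s ≥ t₀, 2 ≤ f s) (h : ∀ s ≥ t₀, f s ^ 2 / 2 - 1 ≤ f' s) : False := by
  -- For `f ≥ 2`, `f²/2 - 1 ≥ f²/4`, so `1/f` falls at rate at least `1/4`; starting below `1/2`, it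
  -- is negative by time `t₀ + 4`.
  have hanti : AntitoneOn (fun s => (f s)⁻¹ + s / 4) (Set.Ici t₀) := by
    have hd : ∀ s ∈ Set.Ici t₀, HasDerivAt (fun s => (f s)⁻¹ + s / 4)
        (-f' s / f s ^ 2 + 1 / 4) s := fun s hs =>
      ((hf s).fun_inv (by linarith [h2 s hs])).add ((hasDerivAt_id' s).div_const 4)
    refine antitoneOn_of_deriv_nonpos (convex_Ici t₀)
      (fun s hs => (hd s hs).continuousAt.continuousWithinAt)
      (fun s hs => (hd s (interior_subset hs)).differentiableAt.differentiableWithinAt)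
      fun s hs => ?_
    have hs := interior_subset hs
    rw [(hd s hs).deriv]
    have h4 := h2 s hs
    have : 1 / 4 ≤ f' s / f s ^ 2 := by
      rw [le_div_iff₀ (by positivity)]
      nlinarith [h s hs]
    rw [neg_div]
    linarith
  have h1 := hanti (Set.self_mem_Ici) (show t₀ + 4 ∈ Set.Ici t₀ by simp) (by linarith)
  have h3 : (f t₀)⁻¹ ≤ 2⁻¹ := inv_anti₀ two_pos (h2 t₀ le_rfl)
  have h4 : 0 < (f (t₀ + 4))⁻¹ := inv_pos.2 (by linarith [h2 (t₀ + 4) (by simp)])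
  simp only at h1
  linarith

end RealFunctions

/-! ### Zero-energy solutions: symmetries and tension-excess equations -/

/-- The functions `a, b, c, d` are the components of a global solution with zero energy. -/
structure ZeroEnergySolution (a b c d : ℝ → ℝ) : Prop where
  deriv_a : ∀ s, HasDerivAt a (b s) s
  deriv_b : ∀ s, HasDerivAt b (c s) s
  deriv_c : ∀ s, HasDerivAt c (d s) s
  deriv_d : ∀ s, HasDerivAt d (F₁ (a s) (c s) + b s ^ 2 * F₂ (a s) (c s)) s
  energy : ∀ s, b s * d s - c s ^ 2 / 2 - (7 + 3 * Real.cos (2 * a s)) / 2 * b s ^ 2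
    - 3 / 2 * b s ^ 4 + 9 / 2 * Real.sin (a s) ^ 2 = 0

/-- The tension `c - sin a cos a`, which vanishes on harmonic maps. -/
noncomputable def tension (a c : ℝ → ℝ) (s : ℝ) : ℝ := c s - Real.sin (a s) * Real.cos (a s)

/-- The excess `b² - sin² a`, which vanishes on harmonic maps. -/
noncomputable def excess (a b : ℝ → ℝ) (s : ℝ) : ℝ := b s ^ 2 - Real.sin (a s) ^ 2

namespace ZeroEnergySolution

variable {a b c d : ℝ → ℝ} (h : ZeroEnergySolution a b c d)
include h

/-- Time reversal. -/
theorem reverse : ZeroEnergySolution (fun s => a (-s)) (fun s => -b (-s)) (fun s => c (-s))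
    (fun s => -d (-s)) where
  deriv_a s := hasDerivAt_comp_neg (h.deriv_a (-s))
  deriv_b s := (hasDerivAt_comp_neg (h.deriv_b (-s))).fun_neg.congr_deriv (by simp)
  deriv_c s := hasDerivAt_comp_neg (h.deriv_c (-s))
  deriv_d s := (hasDerivAt_comp_neg (h.deriv_d (-s))).fun_neg.congr_deriv (by simp)
  energy s := by linear_combination h.energy (-s)

/-- The reflection `a ↦ -a`. -/
theorem neg : ZeroEnergySolution (fun s => -a s) (fun s => -b s) (fun s => -c s)
    (fun s => -d s) where
  deriv_a s := (h.deriv_a s).neg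
  deriv_b s := (h.deriv_b s).neg
  deriv_c s := (h.deriv_c s).neg
  deriv_d s := by
    refine (h.deriv_d s).fun_neg.congr_deriv ?_
    simp only [F₁, F₂, mul_neg, Real.sin_neg, Real.cos_neg]
    ring
  energy s := by
    simp only [mul_neg, Real.sin_neg, Real.cos_neg]
    linear_combination h.energy s

/-- The reflection `a ↦ π - a`. -/
theorem pi_sub : ZeroEnergySolution (fun s => Real.pi - a s) (fun s => -b s) (fun s => -c s)
    (fun s => -d s) where
  deriv_a s := (h.deriv_a s).const_sub _
  deriv_b s := (h.deriv_b s).neg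
  deriv_c s := (h.deriv_c s).neg
  deriv_d s := by
    refine (h.deriv_d s).fun_neg.congr_deriv ?_
    simp only [F₁, F₂, mul_sub, Real.sin_two_pi_sub, Real.cos_two_pi_sub]
    ring
  energy s := by
    simp only [mul_sub, Real.sin_pi_sub, Real.cos_two_pi_sub]
    linear_combination h.energy s

theorem deriv_tension (s : ℝ) : HasDerivAt (tension a c)
    (d s - (Real.cos (a s) ^ 2 - Real.sin (a s) ^ 2) * b s) s := by
  refine ((h.deriv_c s).sub ((h.deriv_a s).sin.mul (h.deriv_a s).cos)).congr_deriv ?_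
  ring

theorem deriv_excess (s : ℝ) : HasDerivAt (excess a b) (2 * b s * tension a c s) s := by
  refine (((h.deriv_b s).pow 2).sub ((h.deriv_a s).sin.pow 2)).congr_deriv ?_
  simp only [tension]
  ring

theorem continuous_excess : Continuous (excess a b) :=
  continuous_iff_continuousAt.2 fun s => (h.deriv_excess s).continuousAt

/-- Conservation of energy in terms of the tension and the excess. -/
theorem energy_tension (s : ℝ) :
    b s * (d s - (Real.cos (a s) ^ 2 - Real.sin (a s) ^ 2) * b s) =
      tension a c s ^ 2 / 2 + tension a c s * (Real.sin (a s) * Real.cos (a s))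
        + excess a b s * (4 + 2 * Real.sin (a s) ^ 2 + 3 / 2 * excess a b s) := by
  have h1 := h.energy s
  rw [Real.cos_two_mul] at h1
  simp only [tension, excess]
  have h2 := Real.sin_sq_add_cos_sq (a s)
  generalize Real.sin (a s) = S at *
  generalize Real.cos (a s) = C at *
  have h3 : C ^ 2 = 1 - S ^ 2 := by linarith
  have h4 : (S * C) ^ 2 = S ^ 2 * (1 - S ^ 2) := by rw [mul_pow, h3]
  rw [h3] at h1 ⊢
  linear_combination h1 + h4 / 2

/-- Barrier at zero tension: only the excess term of the energy identity survives. -/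
theorem tension_deriv_pos {s : ℝ} (hb : 0 < b s) (hu : tension a c s = 0)
    (he : 0 < excess a b s) : 0 < d s - (Real.cos (a s) ^ 2 - Real.sin (a s) ^ 2) * b s := by
  have h1 := h.energy_tension s
  rw [hu] at h1
  refine pos_of_mul_pos_right (a := b s) ?_ hb.le
  rw [h1]
  have : 0 ≤ Real.sin (a s) ^ 2 := sq_nonneg _
  have := mul_pos he (show 0 < 4 + 2 * Real.sin (a s) ^ 2 + 3 / 2 * excess a b s by linarith)
  linarith

/-! ### The blow-up region -/

/-- The region `b > 0`, `tension > 0`, `excess ≥ 0` is forward invariant. -/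
theorem invariant {t s : ℝ} (hb : 0 < b t) (hu : 0 < tension a c t) (he : 0 ≤ excess a b t)
    (hs : t < s) : 0 < b s ∧ 0 < tension a c s ∧ 0 < excess a b s := by
  -- As long as `b * tension > 0` the excess grows, and positive excess keeps `b` away from zero.
  -- Hence the product can only vanish through the tension.
  have pos_b : ∀ r > t, (∀ x ∈ Set.Ico t r, 0 < b x * tension a c x) →
      0 < b r ∧ 0 < excess a b r := by
    intro r hr hpos
    have he' : 0 < excess a b r := by
      have hm : StrictMonoOn (excess a b) (Set.Icc t r) := by
        refine strictMonoOn_of_deriv_pos (convex_Icc t r) h.continuous_excess.continuousOn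
          fun x hx => ?_
        rw [interior_Icc] at hx
        rw [(h.deriv_excess x).deriv]
        have := hpos x ⟨hx.1.le, hx.2⟩
        linarith
      exact he.trans_lt (hm (Set.left_mem_Icc.2 hr.le) (Set.right_mem_Icc.2 hr.le) hr)
    have hne : b r ≠ 0 := by
      intro h0
      simp only [excess, h0] at he'
      nlinarith [sq_nonneg (Real.sin (a r))]
    refine ⟨?_, he'⟩
    by_contra! hbr
    have hcont : ContinuousOn b (Set.Icc t r) := fun x _ =>
      (h.deriv_b x).continuousAt.continuousWithinAt
    obtain ⟨x, hx, hx0⟩ := intermediate_value_Icc' hr.le hcont ⟨hbr, hb.le⟩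
    rcases hx.2.eq_or_lt with rfl | hxr
    · exact hne hx0
    · have := hpos x ⟨hx.1, hxr⟩
      rw [hx0] at this
      simp at this
  have hprod : ∀ r, t ≤ r → 0 < b r * tension a c r := fun r hr =>
    pos_of_deriv_pos_at_first_zero (f := fun r => b r * tension a c r)
      (fun x => (h.deriv_b x).mul (h.deriv_tension x)) (mul_pos hb hu)
      (fun x hx hpos h0 => by
        obtain ⟨hbx, hex⟩ := pos_b x hx hpos
        have hux : tension a c x = 0 := (mul_eq_zero.1 h0).resolve_left hbx.ne'
        have := mul_pos hbx (h.tension_deriv_pos hbx hux hex)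
        rw [hux]
        linarith) hr
  obtain ⟨h1, h2⟩ := pos_b s hs fun x hx => hprod x hx.1
  exact ⟨h1, pos_of_mul_pos_right (hprod s hs.le) h1.le, h2⟩

/-- A solution that enters the region `b > 0`, `tension > 0`, `excess ≥ 0` cannot be global. -/
theorem false_of_pos_tension {t : ℝ} (hb : 0 < b t) (hu : 0 < tension a c t)
    (he : 0 ≤ excess a b t) : False := by
  obtain ⟨hb₁, hu₁, he₁⟩ := h.invariant hb hu he (lt_add_one t)
  set t₁ := t + 1
  have inv : ∀ s ≥ t₁, 0 < b s ∧ 0 < tension a c s ∧ excess a b t₁ ≤ excess a b s := by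
    have hinv : ∀ s ≥ t₁, 0 < b s ∧ 0 < tension a c s ∧ 0 < excess a b s := fun s hs =>
      h.invariant hb hu he (lt_of_lt_of_le (lt_add_one t) hs)
    intro s hs
    refine ⟨(hinv s hs).1, (hinv s hs).2.1, le_of_deriv_nonneg h.deriv_excess (fun x hx => ?_) hs⟩
    have := mul_pos (hinv x hx).1 (hinv x hx).2.1
    linarith
  set η := excess a b t₁
  have sc : ∀ s, |Real.sin (a s) * Real.cos (a s)| ≤ 1 / 2 := fun s => by
    rw [abs_le]
    have := Real.sin_sq_add_cos_sq (a s)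
    constructor <;> nlinarith [sq_nonneg (Real.sin (a s) + Real.cos (a s)),
      sq_nonneg (Real.sin (a s) - Real.cos (a s))]
  -- the tension is bounded below
  obtain ⟨δ, hδ, hδu⟩ : ∃ δ > 0, ∀ s ≥ t₁, δ < tension a c s := by
    -- At the level `tension = δ ≤ η` the energy identity gives `b u' ≥ δ²/2 - δ/2 + 4η > 0`.
    refine ⟨min (tension a c t₁ / 2) η, lt_min (half_pos hu₁) he₁, fun s hs => ?_⟩
    set δ := min (tension a c t₁ / 2) η
    have hδ : 0 < δ := lt_min (half_pos hu₁) he₁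
    refine sub_pos.1 (pos_of_deriv_pos_at_first_zero (f := fun s => tension a c s - δ)
      (fun x => (h.deriv_tension x).sub_const δ) ?_ (fun x hx _ h0 => ?_) hs)
    · linarith [min_le_left (tension a c t₁ / 2) η]
    · obtain ⟨hbx, -, hex⟩ := inv x hx.le
      have h1 := h.energy_tension x
      rw [sub_eq_zero.1 h0] at h1
      refine pos_of_mul_pos_right (a := b x) ?_ hbx.le
      rw [h1]
      have h2 : δ ≤ η := min_le_right _ _
      have h3 := neg_abs_le (Real.sin (a x) * Real.cos (a x))
      have h4 : δ * -(1 / 2) ≤ δ * (Real.sin (a x) * Real.cos (a x)) :=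
        mul_le_mul_of_nonneg_left (by linarith [sc x]) hδ.le
      have h5 : η * 4 ≤ excess a b x * (4 + 2 * Real.sin (a x) ^ 2 + 3 / 2 * excess a b x) :=
        mul_le_mul hex (by nlinarith [sq_nonneg (Real.sin (a x))]) (by norm_num) (by linarith)
      nlinarith [sq_nonneg δ]
  -- so is `b`, and the excess becomes large
  have hbβ : ∀ s ≥ t₁, √η ≤ b s := fun s hs => by
    obtain ⟨hbs, -, hes⟩ := inv s hs
    refine Real.sqrt_le_left hbs.le |>.2 (hes.trans ?_)
    simp only [excess]
    nlinarith [sq_nonneg (Real.sin (a s))]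
  have large : ∀ M, ∃ t₂ ≥ t₁, ∀ s ≥ t₂, M ≤ excess a b s := fun M =>
    exists_le_of_le_deriv (m := 2 * √η * δ) h.deriv_excess (by positivity) (fun s hs => by
      have := hbβ s hs
      have := (hδu s hs).le
      have := (inv s hs).1.le
      gcongr) M
  obtain ⟨t₂, ht₂, he₂⟩ := large 1
  -- the tension is eventually at least half the excess
  have hmono : ∀ s ≥ t₂, tension a c t₂ ^ 2 - 3 / 8 * excess a b t₂ ^ 2 ≤
      tension a c s ^ 2 - 3 / 8 * excess a b s ^ 2 := fun s hs => by
    refine le_of_deriv_nonneg (f := fun s => tension a c s ^ 2 - 3 / 8 * excess a b s ^ 2)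
      (fun x => ((h.deriv_tension x).pow 2).sub (((h.deriv_excess x).pow 2).const_mul (3 / 8)))
      (fun x hx => ?_) hs
    obtain ⟨hbx, hux, -⟩ := inv x (ht₂.trans hx)
    refine nonneg_of_mul_nonneg_right (a := b x) ?_ hbx
    have h1 := h.energy_tension x
    have h2 : b x ^ 2 = excess a b x + Real.sin (a x) ^ 2 := by simp [excess]
    have h3 := he₂ x hx
    have h4 : (Real.sin (a x) * Real.cos (a x)) ^ 2 ≤ (1 / 2) ^ 2 := sq_le_sq.2 (by
      rw [abs_of_pos (show (0 : ℝ) < 1 / 2 by norm_num)]; exact sc x)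
    have h5 : 0 ≤ tension a c x ^ 2 / 2 + tension a c x * (Real.sin (a x) * Real.cos (a x))
        + excess a b x * (4 + 2 * Real.sin (a x) ^ 2 + 3 / 2 * excess a b x)
        - 3 / 4 * excess a b x * b x ^ 2 := by
      rw [h2]
      nlinarith [sq_nonneg (tension a c x + Real.sin (a x) * Real.cos (a x)),
        mul_nonneg (show 0 ≤ excess a b x by linarith) (sq_nonneg (Real.sin (a x))),
        sq_nonneg (excess a b x)]
    have h6 := mul_nonneg (show 0 ≤ 2 * tension a c x by linarith) h5
    rw [← h1] at h6
    push_cast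
    linarith
  set κ := tension a c t₂ ^ 2 - 3 / 8 * excess a b t₂ ^ 2
  -- Since `3/8 > 1/4`, an excess with `e²/8 ≥ |κ|` turns `u² ≥ 3e²/8 + κ` into `u ≥ e/2`; the bound
  -- also yields `b ≥ 2`.
  obtain ⟨t₃, ht₃, he₃⟩ := large (8 * |κ| + 8)
  set t₄ := max t₂ t₃
  have hub : ∀ s ≥ t₄, excess a b s / 2 ≤ tension a c s := fun s hs => by
    have hs2 : s ≥ t₂ := (le_max_left _ _).trans hs
    have h1 := hmono s hs2
    have h2 := he₃ s ((le_max_right _ _).trans hs)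
    have h3 := neg_abs_le κ
    have h4 := abs_nonneg κ
    refine abs_le_of_sq_le_sq' ?_ (inv s (ht₂.trans hs2)).2.1.le |>.2
    nlinarith
  -- `c = u + sin a cos a ≥ e/2 - 1/2 ≥ b²/2 - 1`.
  refine false_of_riccati (t₀ := t₄) h.deriv_b (fun s hs => ?_) fun s hs => ?_
  · have h2 := he₃ s ((le_max_right _ _).trans hs)
    have h4 := abs_nonneg κ
    have h5 := (inv s (ht₃.trans ((le_max_right _ _).trans hs))).1
    simp only [excess] at h2
    nlinarith [sq_nonneg (Real.sin (a s))]
  · have h1 := hub s hs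
    have h2 := (abs_le.1 (sc s)).1
    have h3 := Real.sin_sq_le_one (a s)
    simp only [tension, excess] at h1
    linarith

/-! ### Rigidity at times of nonnegative excess -/

theorem continuous_a : Continuous a :=
  continuous_iff_continuousAt.2 fun s => (h.deriv_a s).continuousAt

/-- Time reversal flips the sign of `b` alone, `neg` flips both `b` and the tension, and both
preserve the excess. So every nonzero tension reduces to the blow-up region. -/
theorem tension_eq_zero {t : ℝ} (hb : b t ≠ 0) (he : 0 ≤ excess a b t) : tension a c t = 0 := by
  have ta : tension (fun s => -a s) (fun s => -c s) t = -tension a c t := by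
    simp only [tension, Real.sin_neg, Real.cos_neg]; ring
  have ea : excess (fun s => -a s) (fun s => -b s) t = excess a b t := by simp [excess]
  rcases lt_trichotomy (tension a c t) 0 with hu | hu | hu
  · rcases hb.lt_or_gt with hb | hb
    · exact (h.neg.false_of_pos_tension (t := t) (by linarith) (by linarith)
        (by linarith)).elim
    · exact (h.neg.reverse.false_of_pos_tension (t := -t) (by simpa using hb)
        (by simpa [tension] using hu) (by simpa [excess] using he)).elim
  · exact hu
  · rcases hb.lt_or_gt with hb | hb
    · exact (h.reverse.false_of_pos_tension (t := -t) (by simpa using hb)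
        (by simpa [tension] using hu) (by simpa [excess] using he)).elim
    · exact (h.false_of_pos_tension hb hu he).elim

/-- Positive excess is an open condition, so the tension vanishes near `t` together with its
derivative; the energy identity then has a positive right side and a zero left side. -/
theorem excess_eq_zero {t : ℝ} (hb : b t ≠ 0) (he : 0 ≤ excess a b t) : excess a b t = 0 := by
  by_contra hne
  have hpos : 0 < excess a b t := lt_of_le_of_ne he (Ne.symm hne)
  have hev : tension a c =ᶠ[𝓝 t] fun _ => 0 := by
    filter_upwards [(h.deriv_b t).continuousAt.eventually_ne hb,
      (h.deriv_excess t).continuousAt.eventually_const_lt hpos] with s h1 h2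
    exact h.tension_eq_zero h1 h2.le
  have h0 := (h.deriv_tension t).unique ((hasDerivAt_const t (0 : ℝ)).congr_of_eventuallyEq hev)
  have h1 := h.energy_tension t
  rw [h0, hev.self_of_nhds] at h1
  have : 0 < excess a b t * (4 + 2 * Real.sin (a t) ^ 2 + 3 / 2 * excess a b t) := by positivity
  linarith

/-- A positive `d` would make `c`, `b`, the tension and the excess positive in turn just after `t`,
entering the blow-up region. -/
theorem not_deriv_pos_of_degenerate {t : ℝ} (hb : b t = 0) (hs : Real.sin (a t) = 0)
    (hc : c t = 0) : ¬ 0 < d t := by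
  intro hd
  have h1 := eventually_lt_nhdsGT_of_deriv_pos (h.deriv_c t) hd
  rw [hc] at h1
  have h2 := eventually_lt_nhdsGT_of_deriv_eventually_pos h.deriv_b h1
  rw [hb] at h2
  have h3 := eventually_lt_nhdsGT_of_deriv_pos (h.deriv_tension t) (by simpa [hb] using hd)
  rw [show tension a c t = 0 by simp [tension, hc, hs]] at h3
  have h4 := eventually_lt_nhdsGT_of_deriv_eventually_pos h.deriv_excess
    (by filter_upwards [h2, h3] with s h5 h6 using mul_pos (mul_pos two_pos h5) h6)
  rw [show excess a b t = 0 by simp [excess, hb, hs]] at h4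
  obtain ⟨s, h5, h6, h7⟩ := (h2.and (h3.and h4)).exists
  exact h.false_of_pos_tension h5 h6 h7.le

/-- If the excess is nonnegative at a critical point of `a`, then this point is an equilibrium. -/
theorem equilibrium {t : ℝ} (hb : b t = 0) (he : 0 ≤ excess a b t) :
    Real.sin (a t) = 0 ∧ c t = 0 ∧ d t = 0 := by
  have hs : Real.sin (a t) = 0 := by
    simp only [excess, hb] at he
    nlinarith [sq_nonneg (Real.sin (a t))]
  have hc : c t = 0 := by
    have := h.energy t
    simp only [hb, hs] at this
    nlinarith [sq_nonneg (c t)]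
  refine ⟨hs, hc, ?_⟩
  have h1 := h.not_deriv_pos_of_degenerate hb hs hc
  have h2 := h.neg.not_deriv_pos_of_degenerate (t := t) (by simp [hb]) (by simp [hs]) (by simp [hc])
  linarith

/-! ### The excess cannot stay negative -/

/-- The quantity `v = c - 3 sin a` becomes positive after `t`, and zero energy forbids its return to
zero while `b > 0`. Hence `b` increases and `a` passes `π`. -/
theorem not_convex_critical (ha : ∀ s, a s ∈ Set.Ioo 0 Real.pi) {t : ℝ} (hb : b t = 0)
    (hc : c t = 3 * Real.sin (a t)) : ¬ 0 ≤ d t := by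
  intro hd
  have sin_pos : ∀ s, 0 < Real.sin (a s) := fun s => Real.sin_pos_of_pos_of_lt_pi (ha s).1 (ha s).2
  set v : ℝ → ℝ := fun s => c s - 3 * Real.sin (a s)
  set v' : ℝ → ℝ := fun s => d s - 3 * (Real.cos (a s) * b s)
  have dv : ∀ s, HasDerivAt v (v' s) s := fun s =>
    (h.deriv_c s).sub ((h.deriv_a s).sin.const_mul 3)
  have vt : v t = 0 := by simp [v, hc]
  have vpos : ∀ᶠ s in 𝓝[>] t, 0 < v s := by
    rw [← vt]
    -- Here `v' = d`. If `d = 0`, the second derivative `sin a (18 cos² a - 18 cos a + 12)` decides.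
    rcases hd.eq_or_lt with hd | hd
    · have dv' := (h.deriv_d t).sub (((h.deriv_a t).cos.mul (h.deriv_b t)).const_mul 3)
      have hev := eventually_lt_nhdsGT_of_deriv_pos dv' (by
        simp only [hb, hc, F₁, F₂, Real.sin_two_mul, Real.cos_two_mul]
        have := mul_pos (sin_pos t) (show 0 < 18 * Real.cos (a t) ^ 2 - 18 * Real.cos (a t) + 12 by
          nlinarith [sq_nonneg (2 * Real.cos (a t) - 1)])
        linarith)
      refine eventually_lt_nhdsGT_of_deriv_eventually_pos dv ?_
      filter_upwards [hev] with s hs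
      simpa [← hd, hb, v'] using hs
    · exact eventually_lt_nhdsGT_of_deriv_pos (dv t) (by simpa [v', hb] using hd)
  have bpos := eventually_lt_nhdsGT_of_deriv_pos (h.deriv_b t)
    (show 0 < c t by rw [hc]; linarith [sin_pos t])
  rw [hb] at bpos
  obtain ⟨t₁, hv₁, hb₁⟩ := (vpos.and bpos).exists
  have b_mono : ∀ x ≥ t₁, (∀ s ∈ Set.Ico t₁ x, 0 < v s) → b t₁ ≤ b x := by
    intro x hx hpos
    have : MonotoneOn b (Set.Icc t₁ x) := by
      refine monotoneOn_of_deriv_nonneg (convex_Icc t₁ x)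
        (fun s _ => (h.deriv_b s).continuousAt.continuousWithinAt)
        (fun s _ => (h.deriv_b s).differentiableAt.differentiableWithinAt) fun s hs => ?_
      rw [interior_Icc] at hs
      rw [(h.deriv_b s).deriv]
      have := hpos s ⟨hs.1.le, hs.2⟩
      simp only [v] at this
      linarith [sin_pos s]
    exact this (Set.left_mem_Icc.2 hx) (Set.right_mem_Icc.2 hx) hx
  have v_pos : ∀ s ≥ t₁, 0 < v s := fun s hs =>
    pos_of_deriv_pos_at_first_zero dv hv₁ (fun x hx hpos h0 => by
      have hbx : 0 < b x := hb₁.trans_le (b_mono x hx.le hpos)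
      refine pos_of_mul_pos_right (a := b x) ?_ hbx.le
      have h1 := h.energy x
      rw [Real.cos_two_mul] at h1
      have h2 : b x * v' x = b x ^ 2 * (3 * Real.cos (a x) ^ 2 - 3 * Real.cos (a x) + 2
          + 3 / 2 * b x ^ 2) := by
        have h3 : c x = 3 * Real.sin (a x) := sub_eq_zero.1 h0
        rw [h3] at h1
        simp only [v']
        linear_combination h1
      rw [h2]
      have : 0 < 3 * Real.cos (a x) ^ 2 - 3 * Real.cos (a x) + 2 := by
        nlinarith [sq_nonneg (2 * Real.cos (a x) - 1)]
      positivity) hs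
  obtain ⟨s, -, hs⟩ := exists_le_of_le_deriv h.deriv_a hb₁
    (fun s hs => b_mono s hs fun x hx => v_pos x hx.1) Real.pi
  exact absurd (hs s le_rfl) (not_le.2 (ha s).2)

/-- A solution with values of `a` in `(0, π)` has no critical points. -/
theorem b_ne_zero (ha : ∀ s, a s ∈ Set.Ioo 0 Real.pi) (t : ℝ) : b t ≠ 0 := by
  have convex : ∀ {a b c d : ℝ → ℝ}, ZeroEnergySolution a b c d →
      (∀ s, a s ∈ Set.Ioo 0 Real.pi) → b t = 0 → c t ≠ 3 * Real.sin (a t) := by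
    intro a b c d h ha hb hc
    rcases le_total 0 (d t) with hd | hd
    · exact h.not_convex_critical ha hb hc hd
    · exact h.reverse.not_convex_critical (t := -t) (fun s => ha (-s)) (by simpa using hb)
        (by simpa using hc) (by simpa using hd)
  intro hb
  have h1 := h.energy t
  rw [hb] at h1
  have h2 : (c t - 3 * Real.sin (a t)) * (c t + 3 * Real.sin (a t)) = 0 := by
    linear_combination -2 * h1
  rcases mul_eq_zero.1 h2 with h3 | h3
  · exact convex h ha hb (sub_eq_zero.1 h3)
  -- The reflection `a ↦ π - a` preserves the strip and changes the sign of `c`.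
  · refine convex h.pi_sub (fun s => ⟨by linarith [(ha s).2], by linarith [(ha s).1]⟩)
      (by simp [hb]) ?_
    rw [Real.sin_pi_sub]
    linarith

/-- With `e < 0` throughout, `b > 0` and the tension eventually stays negative. Then `e` decreases,
`sin a` is bounded below, and `K a - b` grows linearly although it is below `K π`. -/
theorem excess_nonneg_of_pos (ha : ∀ s, a s ∈ Set.Ioo 0 Real.pi)
    (ha0 : Tendsto a atBot (𝓝 0)) (hb0 : Tendsto b atBot (𝓝 0)) :
    ¬ ∀ s, excess a b s < 0 := by
  intro he
  have sin_pos : ∀ s, 0 < Real.sin (a s) := fun s => Real.sin_pos_of_pos_of_lt_pi (ha s).1 (ha s).2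
  have bpos : ∀ s, 0 < b s := by
    by_contra! hneg
    obtain ⟨t, ht⟩ := hneg
    have hcont : Continuous b := continuous_iff_continuousAt.2 fun s => (h.deriv_b s).continuousAt
    have hneg : ∀ s, b s < 0 := fun s => by
      by_contra! hs
      obtain ⟨x, hx⟩ := mem_range_of_exists_le_of_exists_ge hcont ⟨t, ht⟩ ⟨s, hs⟩
      exact h.b_ne_zero ha x hx
    have hanti : Antitone a := antitone_of_deriv_nonpos (fun s => (h.deriv_a s).differentiableAt)
      fun s => by rw [(h.deriv_a s).deriv]; exact (hneg s).le
    have := ge_of_tendsto ha0 ((eventually_le_atBot t).mono fun s hs => hanti hs)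
    exact absurd this (not_le.2 (ha t).1)
  -- Otherwise `e` would increase from its limit `0` at `-∞`.
  obtain ⟨t, hut⟩ : ∃ t, tension a c t < 0 := by
    by_contra! hu
    have hmono : Monotone (excess a b) :=
      monotone_of_deriv_nonneg (fun s => (h.deriv_excess s).differentiableAt) fun s => by
        rw [(h.deriv_excess s).deriv]
        exact mul_nonneg (mul_nonneg zero_le_two (bpos s).le) (hu s)
    have hlim : Tendsto (excess a b) atBot (𝓝 0) := by
      have := (hb0.pow 2).sub (((Real.continuous_sin.tendsto 0).comp ha0).pow 2)
      simp only [Real.sin_zero, sub_self, ne_eq, OfNat.ofNat_ne_zero, not_false_eq_true,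
        zero_pow] at this
      exact this
    have := le_of_tendsto hlim ((eventually_le_atBot 0).mono fun s hs => hmono hs)
    exact absurd this (not_le.2 (he 0))
  have hu : ∀ s ≥ t, 0 < -tension a c s := fun s hs =>
    pos_of_deriv_pos_at_first_zero (f := fun s => -tension a c s)
      (fun x => (h.deriv_tension x).fun_neg) (neg_pos.2 hut) (fun x _ _ h0 => by
        have h1 := h.energy_tension x
        rw [neg_eq_zero.1 h0] at h1
        refine pos_of_mul_pos_right (a := b x) ?_ (bpos x).le
        have h2 : -1 ≤ excess a b x := by
          have := Real.sin_sq_le_one (a x)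
          simp only [excess]
          nlinarith [sq_nonneg (b x)]
        have h3 := mul_pos (neg_pos.2 (he x)) (show 0 < 4 + 2 * Real.sin (a x) ^ 2
          + 3 / 2 * excess a b x by nlinarith [sq_nonneg (Real.sin (a x))])
        linarith) hs
  have he' : ∀ s ≥ t, -excess a b t ≤ -excess a b s := fun s hs =>
    le_of_deriv_nonneg (f := fun s => -excess a b s) (fun x => (h.deriv_excess x).fun_neg)
      (fun x hx => by linarith [mul_pos (bpos x) (hu x hx)]) hs
  set m := √(-excess a b t)
  have hm : 0 < m := Real.sqrt_pos.2 (neg_pos.2 (he t))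
  have hsin : ∀ s ≥ t, m ≤ Real.sin (a s) := fun s hs => by
    refine Real.sqrt_le_left (sin_pos s).le |>.2 ((he' s hs).trans ?_)
    simp only [excess]
    nlinarith [sq_nonneg (b s)]
  -- The second entry makes the inequality below strict at `t`. The first makes `K²/2` exceed `3 + 3
  -- + 2 + 3/2`, a bound for the competing terms as `b² < sin² a ≤ 1`.
  set K := max 5 ((c t + 3 * Real.sin (a t)) / b t + 1)
  have hK5 : 5 ≤ K := le_max_left _ _
  have hK : ∀ s ≥ t, 0 < K * b s - (c s + 3 * Real.sin (a s)) := fun s hs =>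
    pos_of_deriv_pos_at_first_zero (f := fun s => K * b s - (c s + 3 * Real.sin (a s)))
      (fun x => ((h.deriv_b x).const_mul K).sub
        ((h.deriv_c x).add ((h.deriv_a x).sin.const_mul 3)))
      (by
        have : (c t + 3 * Real.sin (a t)) / b t < K :=
          (lt_add_one _).trans_le (le_max_right _ _)
        rw [div_lt_iff₀ (bpos t)] at this
        linarith) (fun x _ _ h0 => by
        have hc : c x = K * b x - 3 * Real.sin (a x) := by linarith
        have h1 := h.energy x
        rw [Real.cos_two_mul] at h1
        refine pos_of_mul_pos_right (a := b x) ?_ (bpos x).le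
        have h2 : b x * (K * c x - (d x + 3 * (Real.cos (a x) * b x))) =
            b x ^ 2 * (K ^ 2 / 2 - (3 * Real.cos (a x) ^ 2 + 3 * Real.cos (a x) + 2
              + 3 / 2 * b x ^ 2)) := by
          rw [hc] at h1 ⊢
          linear_combination -h1
        rw [h2]
        have h3 := he x
        simp only [excess] at h3
        have h4 := Real.sin_sq_le_one (a x)
        have h5 := Real.cos_le_one (a x)
        have h6 := Real.cos_sq_le_one (a x)
        have h7 := bpos x
        refine mul_pos (by positivity) ?_
        nlinarith) hs
  obtain ⟨s, hst, hs⟩ := exists_le_of_le_deriv (f := fun s => K * a s - b s) (t₀ := t)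
    (m := 3 * m) (fun x => ((h.deriv_a x).const_mul K).sub (h.deriv_b x)) (by linarith)
    (fun s hs => by linarith [hK s hs, hsin s hs]) (K * Real.pi)
  have h1 := hs s le_rfl
  have h2 := mul_lt_mul_of_pos_left (ha s).2 (show 0 < K by linarith)
  linarith [bpos s]

/-- A global solution that emanates from the origin has nonnegative excess at some time. -/
theorem exists_excess_nonneg (ha0 : Tendsto a atBot (𝓝 0)) (hb0 : Tendsto b atBot (𝓝 0)) :
    ∃ s, 0 ≤ excess a b s := by
  by_contra! he
  have hsin : ∀ s, Real.sin (a s) ≠ 0 := fun s h0 => by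
    have := he s
    simp only [excess, h0] at this
    nlinarith [sq_nonneg (b s)]
  -- Since `a` never crosses a multiple of `π`, one value in `(0, π)` confines it there.
  have key : ∀ {a b c d : ℝ → ℝ}, ZeroEnergySolution a b c d → Tendsto a atBot (𝓝 0) →
      Tendsto b atBot (𝓝 0) → (∀ s, Real.sin (a s) ≠ 0) → (∀ s, excess a b s < 0) →
      ∀ t, a t < Real.pi → a t ≤ 0 := by
    intro a b c d h ha0 hb0 hsin he t ht
    by_contra! ht0
    refine h.excess_nonneg_of_pos (fun s => ⟨?_, ?_⟩) ha0 hb0 he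
    · by_contra! hs
      obtain ⟨x, hx⟩ := mem_range_of_exists_le_of_exists_ge h.continuous_a ⟨s, hs⟩ ⟨t, ht0.le⟩
      exact hsin x (by rw [hx, Real.sin_zero])
    · by_contra! hs
      obtain ⟨x, hx⟩ := mem_range_of_exists_le_of_exists_ge h.continuous_a ⟨t, ht.le⟩ ⟨s, hs⟩
      exact hsin x (by rw [hx, Real.sin_pi])
  obtain ⟨t, ht, ht'⟩ := ((ha0.eventually_lt_const Real.pi_pos).and
    (ha0.eventually_const_lt (neg_lt_zero.2 Real.pi_pos))).exists
  have h1 := key h ha0 hb0 hsin he t ht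
  have h2 := key h.neg (by simpa using ha0.neg) (by simpa using hb0.neg)
    (fun s => by simpa using hsin s) (fun s => by simpa [excess] using he s) t (by linarith)
  exact hsin t (by rw [show a t = 0 by linarith, Real.sin_zero])

end ZeroEnergySolution

/-! ### Energy on the unstable manifold and the harmonic maps -/

theorem hasDerivAt_coord {Φ : ℝ → Phase} {v : Phase} {s : ℝ} (h : HasDerivAt Φ v s) (i : Fin 4) :
    HasDerivAt (fun s => Φ s i) (v i) s :=
  (EuclideanSpace.proj (𝕜 := ℝ) i).hasFDerivAt.comp_hasDerivAt s h

theorem tendsto_coord {Φ : ℝ → Phase} {l : Filter ℝ} {v : Phase} (h : Tendsto Φ l (𝓝 v))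
    (i : Fin 4) : Tendsto (fun s => Φ s i) l (𝓝 (v i)) :=
  ((EuclideanSpace.proj (𝕜 := ℝ) i).continuous.tendsto v).comp h

/-- The conserved energy of the system. -/
noncomputable def energy (p : Phase) : ℝ :=
  p 1 * p 3 - p 2 ^ 2 / 2 - (7 + 3 * Real.cos (2 * p 0)) / 2 * p 1 ^ 2
    - 3 / 2 * p 1 ^ 4 + 9 / 2 * Real.sin (p 0) ^ 2

theorem continuous_energy : Continuous energy := by
  unfold energy; fun_prop

theorem hasDerivAt_energy {Φ : ℝ → Phase} {s : ℝ} (h : HasDerivAt Φ (field (Φ s)) s) :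
    HasDerivAt (fun s => energy (Φ s)) 0 s := by
  have h0 := hasDerivAt_coord h 0
  have h1 := hasDerivAt_coord h 1
  have h2 := hasDerivAt_coord h 2
  have h3 := hasDerivAt_coord h 3
  refine (((((h1.mul h3).sub ((h2.pow 2).div_const 2)).sub (((((h0.const_mul 2).cos.const_mul
    3).const_add 7).div_const 2).mul (h1.pow 2))).sub ((h1.pow 4).const_mul (3 / 2))).add
    ((h0.sin.pow 2).const_mul (9 / 2))).congr_deriv ?_
  simp only [field, F₁, F₂, Real.sin_two_mul]
  simp
  ring

theorem zeroEnergySolution {Φ : ℝ → Phase} (hΦ : ∀ s, HasDerivAt Φ (field (Φ s)) s)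
    (h0 : Tendsto Φ atBot (𝓝 0)) :
    ZeroEnergySolution (fun s => Φ s 0) (fun s => Φ s 1) (fun s => Φ s 2) (fun s => Φ s 3) where
  deriv_a s := hasDerivAt_coord (hΦ s) 0
  deriv_b s := hasDerivAt_coord (hΦ s) 1
  deriv_c s := hasDerivAt_coord (hΦ s) 2
  deriv_d s := hasDerivAt_coord (hΦ s) 3
  energy s := by
    have hconst : ∀ r, energy (Φ r) = energy (Φ s) := fun r =>
      is_const_of_deriv_eq_zero (fun x => (hasDerivAt_energy (hΦ x)).differentiableAt)
        (fun x => (hasDerivAt_energy (hΦ x)).deriv) r s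
    have hlim : Tendsto (fun r => energy (Φ r)) atBot (𝓝 (energy 0)) :=
      (continuous_energy.tendsto 0).comp h0
    simp only [hconst] at hlim
    have := tendsto_nhds_unique tendsto_const_nhds hlim
    simpa [energy] using this

/-- The solution of the system coming from a solution of `θ' = ε sin θ`. -/
theorem hasDerivAt_of_first_order {θ : ℝ → ℝ} {ε : ℝ} (hε : ε ^ 2 = 1)
    (hθ : ∀ s, HasDerivAt θ (ε * Real.sin (θ s)) s) (s : ℝ) :
    HasDerivAt (fun s => (!₂[θ s, ε * Real.sin (θ s), Real.sin (θ s) * Real.cos (θ s),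
        ε * ((Real.cos (θ s) ^ 2 - Real.sin (θ s) ^ 2) * Real.sin (θ s))] : Phase))
      (field !₂[θ s, ε * Real.sin (θ s), Real.sin (θ s) * Real.cos (θ s),
        ε * ((Real.cos (θ s) ^ 2 - Real.sin (θ s) ^ 2) * Real.sin (θ s))]) s := by
  have hs := (hθ s).sin
  have hc := (hθ s).cos
  refine (PiLp.hasFDerivAt_toLp 2 _).comp_hasDerivAt s (f := fun s => ![θ s, ε * Real.sin (θ s),
    Real.sin (θ s) * Real.cos (θ s),
    ε * ((Real.cos (θ s) ^ 2 - Real.sin (θ s) ^ 2) * Real.sin (θ s))])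
    (f' := ![_, _, _, _]) (hasDerivAt_pi.2 fun i => ?_)
  fin_cases i
  · exact hθ s
  · refine (hs.const_mul ε).congr_deriv ?_
    simp only [Fin.reduceFinMk, Matrix.cons_val]
    linear_combination Real.sin (θ s) * Real.cos (θ s) * hε
  · refine (hs.mul hc).congr_deriv ?_
    simp only [Fin.reduceFinMk, Matrix.cons_val]
    ring
  · refine ((((hc.pow 2).sub (hs.pow 2)).mul hs).const_mul ε).congr_deriv ?_
    simp only [F₁, F₂, Fin.reduceFinMk, Matrix.cons_val, Real.sin_two_mul, Real.cos_two_mul]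
    simp only [Pi.sub_apply, Pi.pow_apply]
    push_cast
    linear_combination Real.sin (θ s) * Real.cos (θ s) *
        (Real.cos (θ s) ^ 2 - 5 * Real.sin (θ s) ^ 2) * hε
      - 5 * Real.sin (θ s) * Real.cos (θ s) * Real.sin_sq_add_cos_sq (θ s)

theorem hasDerivAt_y (s : ℝ) : HasDerivAt y (Real.sin (y s)) s := by
  refine ((Real.hasDerivAt_exp s).arctan.const_mul 2).congr_deriv ?_
  rw [y, Real.sin_two_mul, Real.sin_arctan, Real.cos_arctan]
  have h : 0 < 1 + Real.exp s ^ 2 := by positivity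
  field_simp
  rw [Real.sq_sqrt h.le]

theorem Y_eq (s : ℝ) : Y s = !₂[y s, Real.sin (y s), Real.sin (y s) * Real.cos (y s),
    (Real.cos (y s) ^ 2 - Real.sin (y s) ^ 2) * Real.sin (y s)] := by
  have d1 : iteratedDeriv 1 y = fun s => Real.sin (y s) := by
    rw [iteratedDeriv_one]
    exact funext fun s => (hasDerivAt_y s).deriv
  have d2 : iteratedDeriv 2 y = fun s => Real.sin (y s) * Real.cos (y s) := by
    rw [iteratedDeriv_succ, d1]
    refine funext fun s => ((hasDerivAt_y s).sin.congr_deriv ?_).deriv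
    ring
  have d3 : iteratedDeriv 3 y = fun s =>
      (Real.cos (y s) ^ 2 - Real.sin (y s) ^ 2) * Real.sin (y s) := by
    rw [iteratedDeriv_succ, d2]
    refine funext fun s =>
      (((hasDerivAt_y s).sin.mul (hasDerivAt_y s).cos).congr_deriv ?_).deriv
    ring
  ext i
  fin_cases i <;> simp [Y, d1, d2, d3]

theorem tendsto_y_atBot : Tendsto y atBot (𝓝 0) := by
  have := ((Real.continuous_arctan.tendsto 0).comp Real.tendsto_exp_atBot).const_mul 2
  rw [Real.arctan_zero, mul_zero] at this
  exact this

theorem y_neg (s : ℝ) : y (-s) = Real.pi - y s := by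
  rw [y, y, Real.exp_neg, Real.arctan_inv_of_pos (Real.exp_pos s)]
  ring

theorem exists_y_eq {x : ℝ} (h0 : 0 < x) (hπ : x < Real.pi) : ∃ s, y s = x := by
  have htan : 0 < Real.tan (x / 2) :=
    Real.tan_pos_of_pos_of_lt_pi_div_two (by linarith) (by linarith)
  refine ⟨Real.log (Real.tan (x / 2)), ?_⟩
  rw [y, Real.exp_log htan, Real.arctan_tan (by linarith) (by linarith)]
  ring

/-- Any number with nonzero sine lies on a `π`-translate of the harmonic map `y`. -/
theorem exists_y_add_int_mul_pi {x : ℝ} (hx : Real.sin x ≠ 0) :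
    ∃ (k : ℤ) (r : ℝ), y r + k * Real.pi = x := by
  have h1 := Int.floor_le (x / Real.pi)
  have h2 := Int.lt_floor_add_one (x / Real.pi)
  rw [le_div_iff₀ Real.pi_pos] at h1
  rw [div_lt_iff₀ Real.pi_pos] at h2
  have hne : (⌊x / Real.pi⌋ : ℝ) * Real.pi ≠ x := fun h => hx (by rw [← h, Real.sin_int_mul_pi])
  obtain ⟨r, hr⟩ := exists_y_eq (x := x - ⌊x / Real.pi⌋ * Real.pi)
    (sub_pos.2 (lt_of_le_of_ne h1 hne)) (by linarith)
  exact ⟨_, r, by rw [hr]; ring⟩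

/-- The global nontrivial solutions emanating from the origin are the harmonic maps. -/
theorem eq_Y_of_global {Φ : ℝ → Phase} (hΦ : ∀ s, HasDerivAt Φ (field (Φ s)) s)
    (h0 : Tendsto Φ atBot (𝓝 0)) (hne : ∃ s, Φ s ≠ 0) :
    ∃ τ : ℝ, (∀ s, Φ s = Y (s + τ)) ∨ (∀ s, Φ s = -Y (s + τ)) := by
  have hZ := zeroEnergySolution hΦ h0
  have ha0 : Tendsto (fun s => Φ s 0) atBot (𝓝 0) := by simpa using tendsto_coord h0 0
  have hb0 : Tendsto (fun s => Φ s 1) atBot (𝓝 0) := by simpa using tendsto_coord h0 1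
  have unique : ∀ {Ψ : ℝ → Phase} {t : ℝ}, (∀ s, HasDerivAt Ψ (field (Ψ s)) s) → Φ t = Ψ t →
      Φ = Ψ := fun hΨ ht => funext fun s =>
    SolvesOn.eqOn (I := Set.univ) (fun x _ => (hΦ x).hasDerivWithinAt)
      (fun x _ => (hΨ x).hasDerivWithinAt) (Set.mem_univ _) ht (Set.mem_univ s)
  obtain ⟨t, ht⟩ := hZ.exists_excess_nonneg ha0 hb0
  by_cases hb : Φ t 1 = 0
  · exfalso
    obtain ⟨hs, hc, hd⟩ := hZ.equilibrium hb ht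
    have hfield : field (Φ t) = 0 := by
      ext i
      fin_cases i <;> simp [field, F₁, F₂, hb, hc, hd, hs, Real.sin_two_mul]
    have heq := unique (Ψ := fun _ => Φ t) (t := t)
      (fun s => by rw [hfield]; exact hasDerivAt_const s _) rfl
    rw [heq] at h0
    have hzero := tendsto_nhds_unique tendsto_const_nhds h0
    obtain ⟨s, hs⟩ := hne
    exact hs (by rw [heq]; exact hzero)
  have hu := hZ.tension_eq_zero hb ht
  have he := hZ.excess_eq_zero hb ht
  have hd := hZ.energy_tension t
  rw [hu, he] at hd
  have hd := (mul_eq_zero.1 (hd.trans (by ring))).resolve_left hb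
  simp only [tension, excess] at hu he
  obtain ⟨ε, hε, hbε⟩ : ∃ ε : ℝ, (ε = 1 ∨ ε = -1) ∧ Φ t 1 = ε * Real.sin (Φ t 0) := by
    rcases sq_eq_sq_iff_eq_or_eq_neg.1 (sub_eq_zero.1 he) with h | h
    · exact ⟨1, Or.inl rfl, by linarith⟩
    · exact ⟨-1, Or.inr rfl, by linarith⟩
  have hsin : Real.sin (Φ t 0) ≠ 0 := fun h => hb (by rw [hbε, h, mul_zero])
  obtain ⟨k, r, hkr⟩ := exists_y_add_int_mul_pi hsin
  -- the direction in which the translate of `y` is traversed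
  have hk : ((-1 : ℝ) ^ k = 1 ∨ (-1 : ℝ) ^ k = -1) := by
    rcases Int.even_or_odd k with h | h
    · exact Or.inl h.neg_one_zpow
    · exact Or.inr h.neg_one_zpow
  -- Shifting by `kπ` multiplies the sine by `(-1)^k`, so `θ' = ε sin θ` requires traversing `y`
  -- with this orientation.
  set σ : ℝ := ε * (-1) ^ k
  have hσ : σ = 1 ∨ σ = -1 := by
    rcases hε with h | h <;> rcases hk with h' | h' <;> simp [σ, h, h']
  have hσε : σ = ε * (-1) ^ k := rfl
  clear_value σ
  set θ : ℝ → ℝ := fun s => y (σ * (s - t) + r) + k * Real.pi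
  have hθ : ∀ s, HasDerivAt θ (ε * Real.sin (θ s)) s := fun s => by
    have h1 : HasDerivAt (fun s => σ * (s - t) + r) σ s := by
      simpa using (((hasDerivAt_id' s).sub_const t).const_mul σ).add_const r
    refine (((hasDerivAt_y (σ * (s - t) + r)).comp s h1).add_const _).congr_deriv ?_
    simp only [θ, Real.sin_add_int_mul_pi, hσε]
    ring
  have hε2 : ε ^ 2 = 1 := by rcases hε with h | h <;> simp [h]
  have hθt : θ t = Φ t 0 := by simp [θ, hkr]
  have hsol := unique (t := t) (hasDerivAt_of_first_order hε2 hθ) (by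
    ext i
    fin_cases i
    · simp [hθt]
    · simp [hθt, hbε]
    · simpa [hθt] using sub_eq_zero.1 hu
    · simp only [Fin.reduceFinMk, Matrix.cons_val, hθt]
      rw [sub_eq_zero.1 hd, hbε]
      ring)
  have hlim : Tendsto θ atBot (𝓝 0) := by
    refine ha0.congr fun s => ?_
    rw [hsol]
    simp
  -- The limit of `θ` at `-∞` is `kπ` for `σ = 1` and `(k + 1)π` for `σ = -1`; its vanishing fixes
  -- `k`, and `ε = 1` in both cases.
  rcases hσ with hσ | hσ
  · have hlim' : Tendsto θ atBot (𝓝 (0 + k * Real.pi)) := by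
      refine (tendsto_y_atBot.comp ?_).add_const _
      simp only [hσ, one_mul]
      exact tendsto_atBot_add_const_right _ _ (tendsto_atBot_add_const_right _ (-t) tendsto_id)
    have hk0 : k = 0 := by
      have := tendsto_nhds_unique hlim hlim'
      simpa [Real.pi_ne_zero] using this.symm
    refine ⟨r - t, Or.inl fun s => ?_⟩
    have hθs : θ s = y (s + (r - t)) := by
      simp only [θ, hσ, hk0]
      rw [show 1 * (s - t) + r = s + (r - t) by ring]; simp
    have hε1 : ε = 1 := by simpa [hσ, hk0] using hσε.symm
    rw [hsol, Y_eq]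
    simp [hθs, hε1]
  · have hθs : ∀ s, θ s = (k + 1) * Real.pi - y (s + (-r - t)) := fun s => by
      simp only [θ, hσ]
      rw [show -1 * (s - t) + r = -(s + (-r - t)) by ring, y_neg]
      ring
    have hlim' : Tendsto θ atBot (𝓝 ((k + 1) * Real.pi - 0)) := by
      refine Tendsto.congr (fun s => (hθs s).symm) ((tendsto_y_atBot.comp ?_).const_sub _)
      exact tendsto_atBot_add_const_right _ _ tendsto_id
    have hk0 : (k : ℝ) + 1 = 0 := by
      have := tendsto_nhds_unique hlim hlim'
      simpa [Real.pi_ne_zero] using this.symm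
    have hk1 : k = -1 := by
      have : k + 1 = 0 := by exact_mod_cast hk0
      linarith
    refine ⟨-r - t, Or.inr fun s => ?_⟩
    have hθs' : θ s = -y (s + (-r - t)) := by rw [hθs, hk0]; ring
    have hε1 : ε = 1 := by
      rw [hσ, hk1] at hσε
      norm_num at hσε
      linarith
    rw [hsol, Y_eq]
    ext i
    fin_cases i <;> simp [hθs', hε1]

/-! ### The dichotomy -/

theorem tendsto_zero_of_mem_unstableManifold {Φ : ℝ → Phase}
    (hΦ : ∀ s, HasDerivAt Φ (field (Φ s)) s) (h : Φ 0 ∈ unstableManifold) :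
    Tendsto Φ atBot (𝓝 0) := by
  obtain ⟨Ψ, hΨ, hΨ0, hlim⟩ := h
  have heq : Set.EqOn Ψ Φ (Set.Iic 0) := hΨ.eqOn (fun x _ => (hΦ x).hasDerivWithinAt)
    (Set.self_mem_Iic) hΨ0
  exact hlim.congr' ((eventually_le_atBot 0).mono fun s hs => heq hs)

end EquivariantBiharmonic

theorem theorem3p1 (Φ : ℝ → EquivariantBiharmonic.Phase) (smax : EReal)
    (hmax : EquivariantBiharmonic.IsMaximalSolution Φ smax)
    (horbit : ∀ s ∈ EquivariantBiharmonic.before smax,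
      Φ s ∈ EquivariantBiharmonic.unstableManifold)
    (hnontrivial : ∃ s ∈ EquivariantBiharmonic.before smax, Φ s ≠ 0) :
    Xor
      (smax = ⊤ ∧ ∃ τ : ℝ,
        (∀ s : ℝ, Φ s = EquivariantBiharmonic.Y (s + τ)) ∨
        (∀ s : ℝ, Φ s = -EquivariantBiharmonic.Y (s + τ)))
      (∃ T : ℝ, smax = (T : EReal) ∧ Tendsto (fun s => ‖Φ s‖) (𝓝[<] T) atTop) := by
  induction smax with
  | bot =>
    obtain ⟨s, hs, -⟩ := hnontrivial
    exact (not_lt_bot (show (s : EReal) < ⊥ from hs)).elim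
  | coe T => exact Or.inr ⟨⟨T, rfl, hmax.tendsto_norm_atTop⟩, fun h => EReal.coe_ne_top T h.1⟩
  | top =>
    have huniv : EquivariantBiharmonic.before ⊤ = Set.univ :=
      Set.eq_univ_of_forall fun s => EReal.coe_lt_top s
    have hΦ := hmax.1
    rw [huniv] at hΦ horbit
    have hΦ' := isIntegralCurveOn_univ.1 hΦ
    obtain ⟨s, -, hs⟩ := hnontrivial
    refine Or.inl ⟨⟨rfl, EquivariantBiharmonic.eq_Y_of_global hΦ'
      (EquivariantBiharmonic.tendsto_zero_of_mem_unstableManifold hΦ'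
        (horbit 0 (Set.mem_univ 0))) ⟨s, hs⟩⟩, ?_⟩
    rintro ⟨T, hT, -⟩
    exact EReal.coe_ne_top T hT.symm
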